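/- **Sphere Routing Optimality.** *The graph.* Let $M_0=(V_0,E_0)$ be the graph of the icosahedron. Given the triangle mesh $M_i=(V_i,E_i)$, Loop subdivision produces $M_{i+1}=(V_{i+1},E_{i+1})$: $V_{i+1}=V_i\sqcup L_{i+1}$, where $L_{i+1}$ contains one new vertex (the midpoint) for each edge in $E_i$, and $E_{i+1}$ joins the midpoint of $\{a,b\}\in E_i$ to $a$, to $b$, and to the midpoints of $\{a,c\}$ and $\{b,c\}$ for each triangle $\{a,b,c\}$ of $M_i$ containing $\{a,b\}$. Put $L_0=V_0$. For $k\ge 0$ the VQL graph is $G_k=(V_k,\bigcup_{i=0}^k E_i)$. Let $d$ be the graph distance and $N(\cdot)$ the neighbourhood in $G_k$. The layer of $v\in L_i$ is $l(v)=i$, and its parents are $p(v)=\{w\in N(v): l(w)<l(v)\}$. *Choosing a parent.* For $v\in V_k$, $\mathrm{bestParent}(v)$ is determined by the first of the following that applies. 1. (Parent Rule) If $l(v)\ge1$, $p(v)=\{\pi_1,\pi_2\}$ and $l(\pi_1)<l(\pi_2)$, choose $\pi_1$. 2. (Grandparent Rule) If $l(v)\ge2$, all parents of $v$ have layer at least $1$,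 $p(v)=\{\pi_1,\pi_2\}$ with $l(\pi_1)=l(\pi_2)$, $p(\pi_1)=\{\gamma_1,\gamma_2\}$, $p(\pi_2)=\{\gamma_2,\gamma_3\}$, $l(\gamma_1)<l(\gamma_2)$ and $l(\gamma_1)<l(\gamma_3)$, choose $\pi_1$. 3. Otherwise choose an arbitrary (random) element of $p(v)$. *The global routing algorithm* $\mathrm{path}(\alpha,\beta)$, with sender $\alpha$ and receiver $\beta$: - If $d(\alpha,\beta)\le 6$, run Dijkstra's algorithm from $\alpha$ to $\beta$ (unit edge lengths, ties broken arbitrarily) on the subgraph induced on $N^\alpha=\{\gamma: d(\alpha,\gamma)\le 6\}$, and return the path found. - If $d(\alpha,\beta)>6$ and $l(\beta)>l(\alpha)$, let $\pi=\mathrm{bestParent}(\beta)$ and return $\mathrm{path}(\alpha,\pi)$ followed by $\beta$. - If $d(\alpha,\beta)>6$ and $l(\alpha)\ge l(\beta)$, let $\pi=\mathrm{bestParent}(\alpha)$ and return $\alpha$ followed by $\mathrm{path}(\pi,\beta)$. *Theorem.* Let $k\ge0$ and $\alpha,\beta\in V_k$. (a) If $\alpha\ne\beta$, then the invocation $\mathrm{path}(\alpha,\beta)$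 has at least one possible decision, and whatever the arbitrary choices, it does not fail and finds the next vertex on a shortest path between $\alpha$ and $\beta$. That is, it chooses a vertex $\pi_1\in N(\alpha)$ with $d(\pi_1,\beta)=d(\alpha,\beta)-1$ (the second vertex of the returned path when $d(\alpha,\beta)\le6$; the parent $\mathrm{bestParent}(\alpha)$ when $d(\alpha,\beta)>6$ and $l(\alpha)\ge l(\beta)$), or, when $d(\alpha,\beta)>6$ and $l(\beta)>l(\alpha)$, a vertex $\pi_2=\mathrm{bestParent}(\beta)\in N(\beta)$ with $d(\alpha,\pi_2)=d(\alpha,\beta)-1$. (b) Consequently the recursive algorithm $\mathrm{path}(\alpha,\beta)$ has a result, and every result it can return is a shortest path from $\alpha$ to $\beta$ in $G_k$. -/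

import Mathlib

namespace SphereRouting

/-! ### The VQL graph -/

/-- The 30 edges of the icosahedron: north pole `0`, upper pentagon `1, …, 5`,
lower pentagon `6, …, 10`, south pole `11`. -/
def icosahedronEdges : List (Fin 12 × Fin 12) :=
  [(0, 1), (0, 2), (0, 3), (0, 4), (0, 5),
   (1, 2), (2, 3), (3, 4), (4, 5), (5, 1),
   (1, 6), (2, 7), (3, 8), (4, 9), (5, 10),
   (1, 7), (2, 8), (3, 9), (4, 10), (5, 6),
   (6, 7), (7, 8), (8, 9), (9, 10), (10, 6),
   (6, 11), (7, 11), (8, 11), (9, 11), (10, 11)]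

/-- The graph of the icosahedron. -/
def icosahedron : SimpleGraph (Fin 12) where
  Adj a b := (a, b) ∈ icosahedronEdges ∨ (b, a) ∈ icosahedronEdges
  symm := ⟨fun _ _ h => Or.symm h⟩
  loopless := ⟨by decide⟩

/-- One step of Loop (edge) subdivision of a triangle mesh `M`. The vertices of the new mesh are
the old vertices and one midpoint for each edge of `M`. The midpoint of an edge `{a, b}` is joined
to `a`, to `b`, and to the midpoints of the other two edges of each triangle `a, b, c` of `M`;
no two old vertices are joined. -/
def loopSubdivision {V : Type} (M : SimpleGraph V) : SimpleGraph (V ⊕ M.edgeSet) where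
  Adj x y :=
    match x, y with
    | .inl _, .inl _ => False
    | .inl v, .inr e => v ∈ (e : Sym2 V)
    | .inr e, .inl v => v ∈ (e : Sym2 V)
    | .inr e, .inr f => ∃ a b c, M.Adj a b ∧ M.Adj a c ∧ M.Adj b c ∧
        (e : Sym2 V) = s(a, b) ∧ (f : Sym2 V) = s(a, c)
  symm := ⟨by
    rintro (v | e) (w | f) h
    · exact h
    · exact h
    · exact h
    · obtain ⟨a, b, c, hab, hac, hbc, he, hf⟩ := h
      exact ⟨a, c, b, hac, hab, hbc.symm, hf, he⟩⟩
  loopless := ⟨by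
    rintro (v | e) h
    · exact h
    · obtain ⟨a, b, c, -, -, hbc, he, hf⟩ := h
      exact hbc.ne (Sym2.congr_right.mp (he.symm.trans hf))⟩

/-- The data carried along by the subdivision procedure after `k` rounds: the vertex set `V_k`,
the layer of each vertex (the round in which it was created), the finest triangle mesh
`(V_k, E_k)`, and the VQL graph `G_k = (V_k, E_0 ∪ ⋯ ∪ E_k)`. -/
structure Network where
  V : Type
  layer : V → ℕ
  mesh : SimpleGraph V
  graph : SimpleGraph V

/-- The network after `k` rounds of subdivision of the icosahedron. Old edges stay in the
VQL graph, and the edges of each new mesh are added. -/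
def vqlNetwork : ℕ → Network
  | 0 =>
    { V := Fin 12
      layer := fun _ => 0
      mesh := icosahedron
      graph := icosahedron }
  | k + 1 =>
    { V := (vqlNetwork k).V ⊕ (vqlNetwork k).mesh.edgeSet
      layer := Sum.elim (vqlNetwork k).layer (fun _ => k + 1)
      mesh := loopSubdivision (vqlNetwork k).mesh
      graph := (vqlNetwork k).graph.map Function.Embedding.inl ⊔
        loopSubdivision (vqlNetwork k).mesh }

/-! ### Dijkstra's algorithm -/

/-- State of Dijkstra's algorithm: the explored set, and, for each explored vertex, the distance
label and the path from the source that have been recorded for it. -/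
structure DijkstraState (V : Type) where
  explored : Set V
  dist : V → ℕ
  path : V → List V

/-- Edges along which the explored set can be extended inside `region`. -/
def DijkstraState.Frontier {V : Type} (G : SimpleGraph V) (region : Set V)
    (σ : DijkstraState V) (u v : V) : Prop :=
  u ∈ σ.explored ∧ v ∈ region ∧ v ∉ σ.explored ∧ G.Adj u v

open Classical in
/-- Record that `v` has been reached from the explored vertex `u` over an edge of length `1`. -/
noncomputable def DijkstraState.extend {V : Type} (σ : DijkstraState V) (u v : V) :
    DijkstraState V where
  explored := insert v σ.explored
  dist := Function.update σ.dist v (σ.dist u + 1)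
  path := Function.update σ.path v (σ.path u ++ [v])

/-- The states reachable by Dijkstra's algorithm with source `s` and target `t` on the subgraph of
`G` induced on `region`, all edges having length `1`. In each round, some frontier edge `u v` for
which `dist u + 1` is least possible is selected (ties are broken arbitrarily) and `v` becomes
explored. The algorithm stops when `t` has been explored or no frontier edge is left. -/
inductive DijkstraReaches {V : Type} (G : SimpleGraph V) (region : Set V)
    (s t : V) : DijkstraState V → Prop
  | init : DijkstraReaches G region s t
      { explored := {s}, dist := fun _ => 0, path := fun _ => [s] }
  | round {σ : DijkstraState V} {u v : V} (h : DijkstraReaches G region s t σ)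
      (ht : t ∉ σ.explored) (huv : σ.Frontier G region u v)
      (hmin : ∀ u' v', σ.Frontier G region u' v' → σ.dist u + 1 ≤ σ.dist u' + 1) :
      DijkstraReaches G region s t (σ.extend u v)

/-- The possible results of Dijkstra's algorithm: the path recorded for `t`, or `none` (failure)
if the search is exhausted without having explored `t`. -/
inductive DijkstraReturns {V : Type} (G : SimpleGraph V) (region : Set V)
    (s t : V) : Option (List V) → Prop
  | found {σ : DijkstraState V} (h : DijkstraReaches G region s t σ) (ht : t ∈ σ.explored) :
      DijkstraReturns G region s t (some (σ.path t))
  | exhausted {σ : DijkstraState V} (h : DijkstraReaches G region s t σ) (ht : t ∉ σ.explored)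
      (hfrontier : ∀ u v, ¬ σ.Frontier G region u v) :
      DijkstraReturns G region s t none

namespace Network

variable (N : Network)

/-! ### The Parent Rule and the Grandparent Rule -/

/-- The parents of `a`: its neighbours in the VQL graph that lie on a lower layer. -/
def parents (a : N.V) : Set N.V :=
  {b | N.graph.Adj a b ∧ N.layer b < N.layer a}

/-- The Parent Rule applies to `a` and selects its parent `p₁`: the other parent lies on a
higher layer than `p₁`. -/
def ParentRule (a p₁ : N.V) : Prop :=
  1 ≤ N.layer a ∧ ∃ p₂, N.parents a = {p₁, p₂} ∧ N.layer p₁ < N.layer p₂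

/-- The Grandparent Rule applies to `a` and selects its parent `p₁`: both parents `p₁, p₂` of `a`
lie on the same layer, both have parents, and the parent of `p₁` that is not shared with `p₂`
lies on a lower layer than the other grandparents. -/
def GrandparentRule (a p₁ : N.V) : Prop :=
  2 ≤ N.layer a ∧ (∀ c ∈ N.parents a, 1 ≤ N.layer c) ∧
    ∃ p₂, N.parents a = {p₁, p₂} ∧ N.layer p₁ = N.layer p₂ ∧
      ∃ g₁ g₂ g₃, N.parents p₁ = {g₁, g₂} ∧ N.parents p₂ = {g₂, g₃} ∧
        N.layer g₁ < N.layer g₂ ∧ N.layer g₁ < N.layer g₃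

/-- The possible results of `bestParent(a)`: first try the Parent Rule, then the Grandparent Rule,
and otherwise pick an arbitrary parent; `none` (failure) if a parent has to be picked
but there is none. -/
inductive BestParent (a : N.V) : Option N.V → Prop
  | byParentRule {p : N.V} (h : N.ParentRule a p) : BestParent a (some p)
  | byGrandparentRule {p : N.V} (h₁ : ∀ q, ¬ N.ParentRule a q) (h₂ : N.GrandparentRule a p) :
      BestParent a (some p)
  | byRandom {p : N.V} (h₁ : ∀ q, ¬ N.ParentRule a q) (h₂ : ∀ q, ¬ N.GrandparentRule a q)
      (h : p ∈ N.parents a) : BestParent a (some p)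
  | fail (h₁ : ∀ q, ¬ N.ParentRule a q) (h₂ : ∀ q, ¬ N.GrandparentRule a q)
      (h : N.parents a = ∅) : BestParent a none

/-! ### The global routing algorithm -/

/-- The neighbourhood of order six of `a`. -/
def neighbourhood (a : N.V) : Set N.V :=
  {c | N.graph.dist a c ≤ 6}

/-- What one invocation of the routing algorithm decides: it returns a complete path, or moves
one step from the sender or from the receiver (and then calls itself), or fails. -/
inductive Decision (V : Type) where
  | direct (P : List V)
  | senderStep (p : V)
  | receiverStep (p : V)
  | failure

/-- The possible decisions of one invocation `path(a, b)` of the global routing algorithm with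
sender `a` and receiver `b`. If `b` is in the neighbourhood of order six of `a`, Dijkstra's
algorithm is run on this neighbourhood. Otherwise a step to a best parent is made from the
receiver if it is on a strictly higher layer than the sender, and from the sender if not. -/
inductive Decides (a b : N.V) : Decision N.V → Prop
  | near {P : List N.V} (h : b ∈ N.neighbourhood a)
      (hP : DijkstraReturns N.graph (N.neighbourhood a) a b (some P)) :
      Decides a b (.direct P)
  | nearFail (h : b ∈ N.neighbourhood a)
      (hP : DijkstraReturns N.graph (N.neighbourhood a) a b none) :
      Decides a b .failure
  | receiver {p : N.V} (h : b ∉ N.neighbourhood a) (hl : N.layer a < N.layer b)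
      (hp : N.BestParent b (some p)) : Decides a b (.receiverStep p)
  | receiverFail (h : b ∉ N.neighbourhood a) (hl : N.layer a < N.layer b)
      (hp : N.BestParent b none) : Decides a b .failure
  | sender {p : N.V} (h : b ∉ N.neighbourhood a) (hl : N.layer b ≤ N.layer a)
      (hp : N.BestParent a (some p)) : Decides a b (.senderStep p)
  | senderFail (h : b ∉ N.neighbourhood a) (hl : N.layer b ≤ N.layer a)
      (hp : N.BestParent a none) : Decides a b .failure

/-- The possible results of the complete recursive algorithm `path(a, b)`; `none` is failure. -/
inductive Returns : N.V → N.V → Option (List N.V) → Prop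
  | direct {a b : N.V} {P : List N.V} (h : N.Decides a b (.direct P)) : Returns a b (some P)
  | failure {a b : N.V} (h : N.Decides a b .failure) : Returns a b none
  | receiver {a b p : N.V} {r : Option (List N.V)} (h : N.Decides a b (.receiverStep p))
      (hr : Returns a p r) : Returns a b (r.map fun P => P ++ [b])
  | sender {a b p : N.V} {r : Option (List N.V)} (h : N.Decides a b (.senderStep p))
      (hr : Returns p b r) : Returns a b (r.map fun P => a :: P)

/-- The decision makes a step along a shortest path between `a` and `b`: a neighbour of `a` that
is closer by one to `b` (for a complete path, its second vertex), or a neighbour of `b` that is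
closer by one to `a`. -/
def OptimalDecision (a b : N.V) : Decision N.V → Prop
  | .direct P => ∃ p rest, P = a :: p :: rest ∧
      N.graph.Adj a p ∧ N.graph.dist p b + 1 = N.graph.dist a b
  | .senderStep p => N.graph.Adj a p ∧ N.graph.dist p b + 1 = N.graph.dist a b
  | .receiverStep p => N.graph.Adj b p ∧ N.graph.dist a p + 1 = N.graph.dist a b
  | .failure => False

/-- `P` is the vertex sequence of a shortest path from `a` to `b`. -/
def IsShortestPath (a b : N.V) (P : List N.V) : Prop :=
  P.head? = some a ∧ P.getLast? = some b ∧ P.IsChain N.graph.Adj ∧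
    P.length = N.graph.dist a b + 1

end Network

end SphereRouting

/-!
The proof rests on a recursive description of distances in the VQL graph. Let `G'` arise from `G` by
one more round of subdivision of the mesh `M ≤ G`. Old vertices keep their distances
(`refineGraph_dist_inl_inl`), and a geodesic of length at least three that starts at a new vertex may
be rerouted through a parent of that vertex (`descendsFrom_dist`): adjacent midpoints lie on edges of
a common triangle, so that a path along midpoints can be replaced by a path of old vertices close to
it. For vertices older than the last layer the same descent holds, but the required distance grows by
one with each later round (`descendsFrom_dist_comp`); the bounds 3, 4, 5 for the last three layers
are what the threshold six of the algorithm allows for.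

It follows that some parent of the vertex on the higher layer is closer by one to the other vertex,
and it remains to see that `bestParent` does not choose the other parent. If the parents lie on
different layers, the younger one has distance one more than the least distance of its own parents,
each of which equals or is adjacent to the older one; so the older one is no worse. If they lie on
the same layer, they are the midpoints of two sides `x y` and `x z` of a triangle, and the choice
matters only if one of `y` and `z`, say `z`, is strictly closer to the target than the other two
corners. By `exists_inl_of_strict_min` this forces `z` to be an old vertex and `x`, `y` to be
midpoints, since in a triangle of three midpoints the parent that realises the least distance is
shared by two corners. This uses that the meshes contain no tetrahedra (`NoTetrahedron`), so that
three pairwise adjacent midpoints do come from one triangle. In this situation the Grandparent Rule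
applies and selects the midpoint of `x z` (`Network.IsVQL.not_bestParent_of_corner`). Triangles of
the icosahedron itself do not occur, for the distances involved are at most six.

Dijkstra's algorithm on a ball around the source finds geodesics, as a geodesic from the centre stays
inside the ball (`DijkstraReaches.invariant`). The recursion terminates because each step decreases
the distance between sender and receiver.
-/

namespace SphereRouting

open SimpleGraph

/-! ### Graph distance -/

theorem dist_le_dist_add_one {V : Type} {G : SimpleGraph V} (hG : G.Connected) {u v : V}
    (h : G.Adj u v) (w : V) : G.dist u w ≤ G.dist v w + 1 := by
  have h₁ := hG.dist_triangle (u := u) (v := v) (w := w)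
  have h₂ := dist_eq_one_iff_adj.mpr h
  omega

theorem dist_le_dist_add_one_of_eq_or_adj {V : Type} {G : SimpleGraph V} (hG : G.Connected)
    {u v : V} (h : u = v ∨ G.Adj u v) (w : V) : G.dist u w ≤ G.dist v w + 1 := by
  rcases h with rfl | h
  · omega
  · exact dist_le_dist_add_one hG h w

theorem exists_adj_dist_add_one_eq {V : Type} {G : SimpleGraph V} (hG : G.Connected) {u w : V}
    (h : u ≠ w) : ∃ v, G.Adj u v ∧ G.dist v w + 1 = G.dist u w := by
  obtain ⟨p, hp⟩ := hG.exists_walk_length_eq_dist u w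
  cases p with
  | nil => exact absurd rfl h
  | cons hadj q =>
    refine ⟨_, hadj, ?_⟩
    have h₁ := dist_le q
    have h₂ := dist_le_dist_add_one hG hadj w
    rw [Walk.length_cons] at hp
    omega

theorem exists_walk_of_isChain {V : Type} {G : SimpleGraph V} {b : V} :
    ∀ (P : List V) (a : V), P.head? = some a → P.getLast? = some b → P.IsChain G.Adj →
      ∃ p : G.Walk a b, p.length + 1 = P.length
  | [], a, h, _, _ => by simp at h
  | [x], a, h, h', _ => by
    simp only [List.head?_cons, Option.some.injEq, List.getLast?_singleton] at h h'
    subst h; subst h'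
    exact ⟨.nil, rfl⟩
  | x :: y :: l, a, h, h', hc => by
    simp only [List.head?_cons, Option.some.injEq] at h
    subst h
    rw [List.isChain_cons_cons] at hc
    rw [List.getLast?_cons_cons] at h'
    obtain ⟨p, hp⟩ := exists_walk_of_isChain (y :: l) y rfl h' hc.2
    exact ⟨.cons hc.1 p, by simp [hp]⟩

/-! ### Dijkstra's algorithm -/

/-- A geodesic from `s` to an unexplored vertex `t` crosses an edge that leaves the explored set,
and it does so no later than at `t`. -/
theorem exists_adj_leaving {V : Type} {G : SimpleGraph V} (hG : G.Connected) {s : V} {S : Set V}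
    (hs : s ∈ S) (n : ℕ) : ∀ t, t ∉ S → G.dist s t = n →
    ∃ u v, u ∈ S ∧ v ∉ S ∧ G.Adj u v ∧ G.dist s u + 1 = G.dist s v ∧ G.dist s v ≤ n := by
  induction n using Nat.strong_induction_on with
  | _ n ih =>
    intro t ht hn
    have hts : t ≠ s := fun h => ht (h ▸ hs)
    obtain ⟨u, hu, hd⟩ := exists_adj_dist_add_one_eq hG hts
    rw [dist_comm, dist_comm (u := t)] at hd
    by_cases huS : u ∈ S
    · exact ⟨u, t, huS, ht, hu.symm, hd, hn.le⟩
    · obtain ⟨x, y, hx, hy, hxy, he, hl⟩ := ih _ (by omega) u huS rfl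
      exact ⟨x, y, hx, hy, hxy, he, by omega⟩

/-- `P` is the vertex sequence of a shortest walk from `a` to `b` in `G`. -/
def IsGeodesicList {V : Type} (G : SimpleGraph V) (a b : V) (P : List V) : Prop :=
  P.head? = some a ∧ P.getLast? = some b ∧ P.IsChain G.Adj ∧ P.length = G.dist a b + 1

/-- The invariant of Dijkstra's algorithm on a ball: the labels of the explored vertices are their
distances from the source, and the recorded paths are geodesics. -/
theorem DijkstraReaches.invariant {V : Type} {G : SimpleGraph V} (hG : G.Connected) {s t : V}
    {r : ℕ} {σ : DijkstraState V} (h : DijkstraReaches G {c | G.dist s c ≤ r} s t σ) :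
    s ∈ σ.explored ∧ ∀ v ∈ σ.explored, σ.dist v = G.dist s v ∧ IsGeodesicList G s v (σ.path v) := by
  induction h with
  | init => simp [IsGeodesicList]
  | @round σ u v _ ht huv hmin ih =>
    obtain ⟨hs, hinv⟩ := ih
    obtain ⟨hu, hv, hv', hadj⟩ := huv
    refine ⟨Set.mem_insert_of_mem _ hs, ?_⟩
    have hd : σ.dist u + 1 = G.dist s v := by
      obtain ⟨x, y, hx, hy, hxy, he, hl⟩ := exists_adj_leaving hG hs _ v hv' rfl
      have h₁ := hmin x y ⟨hx, le_trans hl hv, hy, hxy⟩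
      have h₂ := dist_le_dist_add_one hG hadj.symm s
      rw [dist_comm, dist_comm (u := u)] at h₂
      rw [(hinv x hx).1] at h₁
      rw [(hinv u hu).1] at h₁ ⊢
      omega
    intro w hw
    by_cases hwv : w = v
    · subst hwv
      obtain ⟨hdu, hh, hl, hc, hlen⟩ := hinv u hu
      refine ⟨by simpa [DijkstraState.extend] using hd, ?_⟩
      have hP : (σ.extend u w).path w = σ.path u ++ [w] := by simp [DijkstraState.extend]
      rw [hP]
      refine ⟨by simp [List.head?_append, hh], by simp, ?_, ?_⟩
      · rw [List.isChain_append]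
        refine ⟨hc, by simp, ?_⟩
        intro x hx y hy
        rw [hl] at hx
        simp only [Option.mem_def, Option.some.injEq, List.head?_cons] at hx hy
        subst hx; subst hy
        exact hadj
      · rw [List.length_append, hlen, ← hd, hdu]; rfl
    · have hw' : w ∈ σ.explored := hw.resolve_left hwv
      simpa [DijkstraState.extend, hwv] using hinv w hw'

theorem DijkstraReturns.isGeodesicList {V : Type} {G : SimpleGraph V} (hG : G.Connected) {s t : V}
    {r : ℕ} (ht : G.dist s t ≤ r) {o : Option (List V)}
    (h : DijkstraReturns G {c | G.dist s c ≤ r} s t o) :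
    ∃ P, o = some P ∧ IsGeodesicList G s t P := by
  cases h with
  | found h ht => exact ⟨_, rfl, ((h.invariant hG).2 t ht).2⟩
  | exhausted h ht' hf =>
    obtain ⟨x, y, hx, hy, hxy, -, hl⟩ := exists_adj_leaving hG (h.invariant hG).1 _ t ht' rfl
    exact absurd ⟨hx, hl.trans ht, hy, hxy⟩ (hf x y)

theorem exists_dijkstraReturns {V : Type} [Finite V] (G : SimpleGraph V) (region : Set V)
    (s t : V) : ∃ o, DijkstraReturns G region s t o := by
  suffices H : ∀ n (σ : DijkstraState V), σ.exploredᶜ.ncard = n →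
      DijkstraReaches G region s t σ → ∃ o, DijkstraReturns G region s t o from
    H _ _ rfl .init
  intro n
  induction n using Nat.strong_induction_on with
  | _ n ih =>
    intro σ hn hσ
    by_cases ht : t ∈ σ.explored
    · exact ⟨_, .found hσ ht⟩
    by_cases hf : ∀ u v, ¬ σ.Frontier G region u v
    · exact ⟨_, .exhausted hσ ht hf⟩
    classical
    push Not at hf
    have hex : ∃ m, ∃ u v, σ.Frontier G region u v ∧ σ.dist u = m := by
      obtain ⟨u, v, h⟩ := hf
      exact ⟨_, u, v, h, rfl⟩
    obtain ⟨u, v, huv, hm⟩ := Nat.find_spec hex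
    refine ih _ ?_ (σ.extend u v) rfl (.round hσ ht huv fun u' v' h' => ?_)
    · rw [← hn]
      refine Set.ncard_lt_ncard ⟨Set.compl_subset_compl.mpr (Set.subset_insert v _), fun h => ?_⟩
      exact h huv.2.2.1 (Set.mem_insert v _)
    · rw [hm]
      exact Nat.succ_le_succ (Nat.find_min' hex ⟨u', v', h', rfl⟩)

/-! ### Distances under subdivision -/

/-- The VQL graph after one more round of subdivision, from the mesh `M` and the VQL graph `G`. -/
def refineGraph {V : Type} (M G : SimpleGraph V) : SimpleGraph (V ⊕ M.edgeSet) :=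
  G.map Function.Embedding.inl ⊔ loopSubdivision M

section refineGraph

variable {V : Type} {M G : SimpleGraph V}

@[simp] theorem refineGraph_adj_inl_inl {x y : V} :
    (refineGraph M G).Adj (.inl x) (.inl y) ↔ G.Adj x y := by
  rw [refineGraph, sup_adj]
  exact ⟨fun h => h.elim (fun h => (map_adj_apply (f := Function.Embedding.inl)).mp h) False.elim,
    fun h => .inl ((map_adj_apply (f := Function.Embedding.inl)).mpr h)⟩

@[simp] theorem refineGraph_adj_inl_inr {x : V} {e : M.edgeSet} :
    (refineGraph M G).Adj (.inl x) (.inr e) ↔ x ∈ (e : Sym2 V) := by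
  simp [refineGraph, loopSubdivision]

@[simp] theorem refineGraph_adj_inr_inl {x : V} {e : M.edgeSet} :
    (refineGraph M G).Adj (.inr e) (.inl x) ↔ x ∈ (e : Sym2 V) := by
  simp [refineGraph, loopSubdivision]

@[simp] theorem refineGraph_adj_inr_inr {e f : M.edgeSet} :
    (refineGraph M G).Adj (.inr e) (.inr f) ↔ (loopSubdivision M).Adj (.inr e) (.inr f) := by
  simp [refineGraph]

theorem eq_or_adj_of_mem_edge {e : M.edgeSet} {x y : V} (hx : x ∈ (e : Sym2 V))
    (hy : y ∈ (e : Sym2 V)) : x = y ∨ M.Adj x y := by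
  obtain ⟨e, he⟩ := e
  induction e with
  | _ a b =>
    rw [mem_edgeSet] at he
    rcases Sym2.mem_iff.mp hx with rfl | rfl <;> rcases Sym2.mem_iff.mp hy with rfl | rfl
    exacts [.inl rfl, .inr he, .inr he.symm, .inl rfl]

theorem exists_mem_edge (e : M.edgeSet) : ∃ x, x ∈ (e : Sym2 V) := by
  obtain ⟨e, he⟩ := e
  induction e with
  | _ a b => exact ⟨a, Sym2.mem_mk_left a b⟩

theorem exists_common_of_loop_adj {e f : M.edgeSet}
    (h : (loopSubdivision M).Adj (.inr e) (.inr f)) :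
    ∃ x, x ∈ (e : Sym2 V) ∧ x ∈ (f : Sym2 V) := by
  obtain ⟨a, b, c, -, -, -, he, hf⟩ := h
  exact ⟨a, he ▸ Sym2.mem_mk_left a b, hf ▸ Sym2.mem_mk_left a c⟩

/-- Adjacent midpoints lie on edges of a common triangle. -/
theorem eq_or_adj_of_loop_adj {e f : M.edgeSet}
    (h : (loopSubdivision M).Adj (.inr e) (.inr f)) {x y : V} (hx : x ∈ (e : Sym2 V))
    (hy : y ∈ (f : Sym2 V)) : x = y ∨ M.Adj x y := by
  obtain ⟨a, b, c, hab, hac, hbc, he, hf⟩ := h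
  rw [he] at hx
  rw [hf] at hy
  rcases Sym2.mem_iff.mp hx with rfl | rfl <;> rcases Sym2.mem_iff.mp hy with rfl | rfl
  exacts [.inl rfl, .inr hac, .inr hab.symm, .inr hbc]

theorem refineGraph_connected (hG : G.Connected) : (refineGraph M G).Connected := by
  have hinl : ∀ x y, (refineGraph M G).Reachable (.inl x) (.inl y) := fun x y =>
    (hG x y).map (⟨Sum.inl, fun h => by simpa using h⟩ : G →g refineGraph M G)
  obtain ⟨x₀⟩ := hG.nonempty
  have : ∀ z, (refineGraph M G).Reachable z (.inl x₀) := by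
    rintro (x | e)
    · exact hinl x x₀
    · obtain ⟨x, hx⟩ := exists_mem_edge e
      have : (refineGraph M G).Adj (.inr e) (.inl x) := by simpa using hx
      exact this.reachable.trans (hinl x x₀)
  exact { preconnected := fun u v => (this u).trans (this v).symm, nonempty := ⟨.inl x₀⟩ }

/-- The function sending an old vertex to its old distance from `y`, and a midpoint to one more than
the least old distance of an endpoint, does not drop faster than by one along the edges of the
refined graph. -/
theorem le_length_of_refineGraph_walk (hG : G.Connected) (hM : M ≤ G) (y : V)
    (n : ℕ) : ∀ z, ∀ p : (refineGraph M G).Walk z (.inl y), p.length = n →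
      Sum.elim (fun x => G.dist x y ≤ n)
        (fun e : M.edgeSet => ∃ x ∈ (e : Sym2 V), G.dist x y + 1 ≤ n) z := by
  have hstep : ∀ {a b : V}, a = b ∨ M.Adj a b → G.dist a y ≤ G.dist b y + 1 := fun h =>
    dist_le_dist_add_one_of_eq_or_adj hG (h.imp_right fun h => hM h) y
  induction n with
  | zero =>
    intro z p hp
    cases p with
    | nil => simp
    | cons h q => simp at hp
  | succ n ih =>
    intro z p hp
    cases p with
    | nil => simp at hp
    | @cons _ z' _ h q =>
      rw [Walk.length_cons, Nat.succ_inj] at hp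
      have hq := ih _ q hp
      rcases z with x | e <;> rcases z' with x' | f <;>
        simp only [Sum.elim_inl, Sum.elim_inr, refineGraph_adj_inl_inl, refineGraph_adj_inl_inr,
          refineGraph_adj_inr_inl, refineGraph_adj_inr_inr] at h hq ⊢
      · have := dist_le_dist_add_one hG h y
        omega
      · obtain ⟨x', hx', hd⟩ := hq
        have := hstep (eq_or_adj_of_mem_edge h hx')
        omega
      · exact ⟨x', h, by omega⟩
      · obtain ⟨x', hx', hd⟩ := hq
        obtain ⟨c, hce, hcf⟩ := exists_common_of_loop_adj h
        have := hstep (eq_or_adj_of_mem_edge hcf hx')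
        exact ⟨c, hce, by omega⟩

/-- The old VQL graph is an isometric subgraph of the new one. -/
theorem refineGraph_dist_inl_inl (hG : G.Connected) (hM : M ≤ G) (x y : V) :
    (refineGraph M G).dist (.inl x) (.inl y) = G.dist x y := by
  apply le_antisymm
  · obtain ⟨p, hp⟩ := hG.exists_walk_length_eq_dist x y
    rw [← hp, ← Walk.length_map
      (⟨Sum.inl, fun h => by simpa using h⟩ : G →g refineGraph M G)]
    exact dist_le _
  · obtain ⟨p, hp⟩ :=
      (refineGraph_connected (M := M) hG).exists_walk_length_eq_dist (.inl x) (.inl y)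
    exact le_length_of_refineGraph_walk hG hM y _ (.inl x) p hp

theorem exists_mem_dist_add_one_le (hG : G.Connected) (hM : M ≤ G) (e : M.edgeSet) (y : V) :
    ∃ x ∈ (e : Sym2 V), G.dist x y + 1 ≤ (refineGraph M G).dist (.inr e) (.inl y) := by
  obtain ⟨p, hp⟩ :=
    (refineGraph_connected (M := M) hG).exists_walk_length_eq_dist (.inr e) (.inl y)
  exact le_length_of_refineGraph_walk hG hM y _ (.inr e) p hp

/-- A function `D` on the refined vertex set descends to parents above the threshold `t`: each
midpoint whose value is at least `t` has an endpoint of smaller value. -/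
def DescendsFrom (M : SimpleGraph V) (t : ℕ) (D : V ⊕ M.edgeSet → ℕ) : Prop :=
  ∀ e : M.edgeSet, t ≤ D (.inr e) → ∃ x ∈ (e : Sym2 V), D (.inl x) + 1 ≤ D (.inr e)

/-- The distance from a vertex descends to parents: as soon as three edges of a geodesic are
available, a stretch of it that passes through midpoints can be replaced by a stretch of at most the
same length through their endpoints. -/
theorem descendsFrom_dist (hG : G.Connected) (hM : M ≤ G) (z : V ⊕ M.edgeSet) :
    DescendsFrom M 3 fun u => (refineGraph M G).dist u z := by
  have hG' := refineGraph_connected (M := M) hG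
  -- One step along a geodesic towards `z`.
  have hgeo : ∀ u, 1 ≤ (refineGraph M G).dist u z → ∃ v, (refineGraph M G).Adj u v ∧
      (refineGraph M G).dist v z + 1 = (refineGraph M G).dist u z := fun u hu =>
    exists_adj_dist_add_one_eq hG' fun h => by simp [h] at hu
  have hstep : ∀ {a b : V}, a = b ∨ M.Adj a b →
      (refineGraph M G).dist (.inl a) z ≤ (refineGraph M G).dist (.inl b) z + 1 := fun h =>
    dist_le_dist_add_one_of_eq_or_adj hG'
      (h.imp (congrArg _) fun h => by simpa using hM h) z
  have hmem : ∀ {a : V} {e : M.edgeSet}, a ∈ (e : Sym2 V) →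
      (refineGraph M G).dist (.inl a) z ≤ (refineGraph M G).dist (.inr e) z + 1 := fun h =>
    dist_le_dist_add_one hG' (by simpa using h) z
  intro e he
  beta_reduce at he ⊢
  obtain ⟨z₂, h₂, hd₂⟩ := hgeo (.inr e) (by omega)
  rcases z₂ with x | e₂
  · exact ⟨x, by simpa using h₂, by omega⟩
  rw [refineGraph_adj_inr_inr] at h₂
  obtain ⟨c, hce, hc₂⟩ := exists_common_of_loop_adj h₂
  refine ⟨c, hce, ?_⟩
  obtain ⟨z₃, h₃, hd₃⟩ := hgeo (.inr e₂) (by omega)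
  rcases z₃ with x | e₃
  · have := hstep (eq_or_adj_of_mem_edge hc₂ (by simpa using h₃ : x ∈ (e₂ : Sym2 V)))
    omega
  rw [refineGraph_adj_inr_inr] at h₃
  obtain ⟨z₄, h₄, hd₄⟩ := hgeo (.inr e₃) (by omega)
  rcases z₄ with x | e₄
  · have := hstep (eq_or_adj_of_loop_adj h₃ hc₂ (by simpa using h₄ : x ∈ (e₃ : Sym2 V)))
    omega
  rw [refineGraph_adj_inr_inr] at h₄
  obtain ⟨c', hc₃, hc₄⟩ := exists_common_of_loop_adj h₄
  have h₅ := hstep (eq_or_adj_of_loop_adj h₃ hc₂ hc₃)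
  have h₆ := hmem hc₄
  omega

/-- Passing from the distances to old vertices to the distances to new ones costs one in the
threshold of descent, for any subdivision `M₀` whose vertices are mapped to old vertices by `i`. -/
theorem descendsFrom_dist_comp {W : Type} {M₀ : SimpleGraph W} (i : W ⊕ M₀.edgeSet → V)
    (hG : G.Connected) (hM : M ≤ G) {t : ℕ}
    (h : ∀ y, DescendsFrom M₀ t fun u => G.dist (i u) y) (z : V ⊕ M.edgeSet) :
    DescendsFrom M₀ (t + 1) fun u => (refineGraph M G).dist (.inl (i u)) z := by
  intro e he
  rcases z with y | g
  · simp only [refineGraph_dist_inl_inl hG hM] at he ⊢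
    exact h y e (Nat.le_of_succ_le he)
  · have hG' := refineGraph_connected (M := M) hG
    obtain ⟨y, hy, hd⟩ := exists_mem_dist_add_one_le hG hM g (i (.inr e))
    rw [SimpleGraph.dist_comm, SimpleGraph.dist_comm (v := Sum.inl _)] at hd
    beta_reduce at he ⊢
    have hle : ∀ u, (refineGraph M G).dist (.inl u) (.inr g) ≤ G.dist u y + 1 := by
      intro u
      have h₁ := hG'.dist_triangle (u := .inl u) (v := .inl y) (w := .inr g)
      have h₂ : (refineGraph M G).dist (.inl y) (.inr g) = 1 :=
        dist_eq_one_iff_adj.mpr (by simpa using hy)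
      rwa [refineGraph_dist_inl_inl hG hM, h₂] at h₁
    have hie := hle (i (.inr e))
    obtain ⟨x, hx, hd'⟩ := h y e (by beta_reduce; omega)
    have hix := hle (i (.inl x))
    beta_reduce at hd' ⊢
    exact ⟨x, hx, by omega⟩

end refineGraph

/-! ### Triangles of subdivided meshes -/

/-- No four vertices of the mesh are pairwise adjacent. -/
def NoTetrahedron {V : Type} (M : SimpleGraph V) : Prop :=
  ∀ a b c d, M.Adj a b → M.Adj a c → M.Adj a d → M.Adj b c → M.Adj b d → ¬ M.Adj c d

/-- In a mesh without tetrahedra, three pairwise adjacent midpoints are those of one triangle. -/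
theorem NoTetrahedron.exists_triangle {V : Type} {M : SimpleGraph V} (hM : NoTetrahedron M)
    {e f g : M.edgeSet} (hef : (loopSubdivision M).Adj (.inr e) (.inr f))
    (heg : (loopSubdivision M).Adj (.inr e) (.inr g))
    (hfg : (loopSubdivision M).Adj (.inr f) (.inr g)) :
    ∃ a b c, M.Adj a b ∧ M.Adj a c ∧ M.Adj b c ∧
      (e : Sym2 V) = s(a, b) ∧ (f : Sym2 V) = s(a, c) ∧ (g : Sym2 V) = s(b, c) := by
  obtain ⟨a, b, c, hab, hac, hbc, he, hf⟩ := hef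
  obtain ⟨a₁, b₁, c₁, -, hac₁, hbc₁, he₁, hg₁⟩ := heg
  obtain ⟨a₂, b₂, c₂, -, hac₂, hbc₂, hf₂, hg₂⟩ := hfg
  refine ⟨a, b, c, hab, hac, hbc, he, hf, ?_⟩
  rw [he, Sym2.eq_iff] at he₁
  rw [hf, Sym2.eq_iff] at hf₂
  rw [hg₁, Sym2.eq_iff] at hg₂
  rw [hg₁]
  rcases he₁ with ⟨rfl, rfl⟩ | ⟨rfl, rfl⟩ <;> rcases hf₂ with ⟨rfl, rfl⟩ | ⟨rfl, rfl⟩ <;>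
    rcases hg₂ with ⟨h, rfl⟩ | ⟨h, h'⟩
  · exact absurd hbc₂ (hM _ _ _ _ hab hac hac₁ hbc hbc₁)
  · exact absurd h hac₂.ne
  · exact absurd h hac.ne
  · subst h; exact absurd hbc₂ (SimpleGraph.irrefl _)
  · exact absurd h.symm hab.ne
  · subst h'; exact absurd hbc₁ (SimpleGraph.irrefl _)
  · exact absurd h hbc.ne
  · rw [h']

theorem NoTetrahedron.loopSubdivision {V : Type} {M : SimpleGraph V} (hM : NoTetrahedron M) :
    NoTetrahedron (loopSubdivision M) := by
  -- No old vertex is adjacent to three pairwise adjacent midpoints.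
  have hinl : ∀ (v : V) (e f g : M.edgeSet), v ∈ (e : Sym2 V) → v ∈ (f : Sym2 V) →
      v ∈ (g : Sym2 V) → (SphereRouting.loopSubdivision M).Adj (.inr e) (.inr f) →
      (SphereRouting.loopSubdivision M).Adj (.inr e) (.inr g) →
      ¬ (SphereRouting.loopSubdivision M).Adj (.inr f) (.inr g) := by
    intro v e f g he hf hg hef heg hfg
    obtain ⟨a, b, c, hab, hac, hbc, he', hf', hg'⟩ := hM.exists_triangle hef heg hfg
    rw [he', Sym2.mem_iff] at he
    rw [hf', Sym2.mem_iff] at hf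
    rw [hg', Sym2.mem_iff] at hg
    have := hab.ne; have := hac.ne; have := hbc.ne
    grind
  rintro (a | e) (b | f) (c | g) (d | h) hab hac had hbc hbd hcd
  all_goals first
    | exact hab | exact hac | exact had | exact hbc | exact hbd | exact hcd
    | skip
  · exact hinl a f g h hab hac had hbc hbd hcd
  · exact hinl b e g h hab hbc hbd hac had hcd
  · exact hinl c e f h hac hbc hcd hab had hbd
  · exact hinl d e f g had hbd hcd hab hac hbc
  · obtain ⟨a, b, c, h₁, h₂, h₃, he, hf, hg⟩ := hM.exists_triangle hab hac hbc
    obtain ⟨a', b', c', h₁', h₂', h₃', he', hf', hh⟩ := hM.exists_triangle hab had hbd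
    refine hcd.ne (congrArg Sum.inr (Subtype.ext ?_))
    rw [he, Sym2.eq_iff] at he'
    rw [hf, Sym2.eq_iff] at hf'
    rw [hg, hh]
    have := h₁.ne; have := h₂.ne; have := h₃.ne
    grind

/-! ### The icosahedron -/

instance : DecidableRel icosahedron.Adj := fun a b =>
  inferInstanceAs (Decidable ((a, b) ∈ icosahedronEdges ∨ (b, a) ∈ icosahedronEdges))

theorem icosahedron_noTetrahedron : NoTetrahedron icosahedron := by
  have : ∀ a b, icosahedron.Adj a b → ∀ c, icosahedron.Adj a c → icosahedron.Adj b c →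
      ∀ d, icosahedron.Adj a d → icosahedron.Adj b d → ¬ icosahedron.Adj c d := by decide +kernel
  exact fun a b c d hab hac had hbc hbd => this a b hab c hac hbc d had hbd

theorem icosahedron_connected : icosahedron.Connected := by
  have h : ∀ b, ∃ c d, (0 = c ∨ icosahedron.Adj 0 c) ∧ (c = d ∨ icosahedron.Adj c d) ∧
      (d = b ∨ icosahedron.Adj d b) := by decide +kernel
  have hr : ∀ {a b : Fin 12}, a = b ∨ icosahedron.Adj a b → icosahedron.Reachable a b := by
    rintro a b (rfl | h)
    exacts [.rfl, h.reachable]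
  have h₀ : ∀ b, icosahedron.Reachable 0 b := fun b => by
    obtain ⟨c, d, h₁, h₂, h₃⟩ := h b
    exact (hr h₁).trans ((hr h₂).trans (hr h₃))
  exact { preconnected := fun a b => (h₀ a).symm.trans (h₀ b) }

/-- All vertices of the icosahedron but the antipode of `u` are within distance two of `u`. -/
theorem exists_antipode (u : Fin 12) : ∃ t, ∀ a, a ≠ t → icosahedron.dist a u ≤ 2 := by
  have h : ∀ u : Fin 12, ∃ t, ∀ a, a ≠ t → ∃ c, (a = c ∨ icosahedron.Adj a c) ∧
      (c = u ∨ icosahedron.Adj c u) := by decide +kernel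
  obtain ⟨t, ht⟩ := h u
  refine ⟨t, fun a ha => ?_⟩
  obtain ⟨c, hac, hcu⟩ := ht a ha
  have h₁ := dist_le_dist_add_one_of_eq_or_adj icosahedron_connected hac u
  have h₂ := dist_le_dist_add_one_of_eq_or_adj icosahedron_connected hcu u
  rw [SimpleGraph.dist_self] at h₂
  omega

theorem icosahedron_dist_le_two_of_adj {x y : Fin 12} (h : icosahedron.Adj x y) (u : Fin 12) :
    icosahedron.dist x u ≤ 2 ∨ icosahedron.dist y u ≤ 2 := by
  obtain ⟨t, ht⟩ := exists_antipode u
  by_cases hx : x = t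
  · exact .inr (ht y fun hy => h.ne (hx.trans hy.symm))
  · exact .inl (ht x hx)

theorem icosahedron_dist_le_three (a u : Fin 12) : icosahedron.dist a u ≤ 3 := by
  have h : ∀ a, ∃ b, icosahedron.Adj a b := by decide +kernel
  obtain ⟨b, hb⟩ := h a
  have h₁ := icosahedron_dist_le_two_of_adj hb u
  have h₂ := dist_le_dist_add_one icosahedron_connected hb u
  omega

namespace Network

/-! ### Refinement of networks -/

/-- The network after one more round of subdivision, the new vertices being put on layer `n`. -/
abbrev refine (N : Network) (n : ℕ) : Network where
  V := N.V ⊕ N.mesh.edgeSet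
  layer := Sum.elim N.layer fun _ => n
  mesh := loopSubdivision N.mesh
  graph := refineGraph N.mesh N.graph

/-- The properties of the network after `n` rounds of subdivision that do not refer to layers other
than the last one. -/
structure IsVQL (N : Network) (n : ℕ) : Prop where
  finite : Finite N.V
  layer_le : ∀ v, N.layer v ≤ n
  mesh_le : N.mesh ≤ N.graph
  connected : N.graph.Connected
  noTetrahedron : NoTetrahedron N.mesh

variable {N : Network} {n : ℕ}

theorem IsVQL.refine (h : N.IsVQL n) : (N.refine (n + 1)).IsVQL (n + 1) where
  finite := by
    have := h.finite
    exact inferInstanceAs (Finite (N.V ⊕ N.mesh.edgeSet))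
  layer_le := by
    rintro (v | e)
    · exact (h.layer_le v).trans n.le_succ
    · exact le_rfl
  mesh_le := le_sup_right (a := N.graph.map Function.Embedding.inl)
  connected := refineGraph_connected h.connected
  noTetrahedron := h.noTetrahedron.loopSubdivision

theorem isVQL_vqlNetwork : ∀ k, (vqlNetwork k).IsVQL k
  | 0 =>
    { finite := inferInstanceAs (Finite (Fin 12))
      layer_le := fun _ => le_rfl
      mesh_le := le_refl icosahedron
      connected := icosahedron_connected
      noTetrahedron := icosahedron_noTetrahedron }
  | k + 1 => (isVQL_vqlNetwork k).refine

theorem exists_dist_inl_le_one (m : ℕ) (w : (N.refine m).V) :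
    ∃ u, (N.refine m).graph.dist (.inl u) w ≤ 1 := by
  rcases w with u | e
  · exact ⟨u, (SimpleGraph.dist_self (G := (N.refine m).graph)).trans_le zero_le_one⟩
  · obtain ⟨u, hu⟩ := exists_mem_edge e
    exact ⟨u, (dist_eq_one_iff_adj.mpr (refineGraph_adj_inl_inr.mpr hu)).le⟩

/-! ### Parents and best parents -/

theorem BestParent.exists_mem {a : N.V} {o : Option N.V} (h : N.BestParent a o)
    (ha : (N.parents a).Nonempty) : ∃ p ∈ N.parents a, o = some p := by
  cases h with
  | byParentRule h =>
    obtain ⟨-, p₂, hp, -⟩ := h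
    exact ⟨_, hp ▸ Set.mem_insert _ _, rfl⟩
  | byGrandparentRule _ h =>
    obtain ⟨-, -, p₂, hp, -⟩ := h
    exact ⟨_, hp ▸ Set.mem_insert _ _, rfl⟩
  | byRandom _ _ h => exact ⟨_, h, rfl⟩
  | fail _ _ h => exact absurd h ha.ne_empty

theorem exists_bestParent (a : N.V) : ∃ o, N.BestParent a o := by
  by_cases h₁ : ∃ q, N.ParentRule a q
  · exact h₁.elim fun q h => ⟨_, .byParentRule h⟩
  by_cases h₂ : ∃ q, N.GrandparentRule a q
  · exact h₂.elim fun q h => ⟨_, .byGrandparentRule (not_exists.mp h₁) h⟩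
  rcases (N.parents a).eq_empty_or_nonempty with h | ⟨p, hp⟩
  · exact ⟨_, .fail (not_exists.mp h₁) (not_exists.mp h₂) h⟩
  · exact ⟨_, .byRandom (not_exists.mp h₁) (not_exists.mp h₂) hp⟩

theorem ParentRule.unique {a p q : N.V} (hp : N.ParentRule a p) (hq : N.ParentRule a q) :
    p = q := by
  obtain ⟨-, p₂, hp, hpl⟩ := hp
  obtain ⟨-, q₂, hq, hql⟩ := hq
  rw [hp, Set.pair_eq_pair_iff] at hq
  rcases hq with ⟨h, -⟩ | ⟨rfl, rfl⟩
  · exact h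
  · omega

theorem BestParent.eq_of_parentRule {a p q : N.V} (hp : N.BestParent a (some p))
    (hq : N.ParentRule a q) : p = q := by
  cases hp with
  | byParentRule h => exact h.unique hq
  | byGrandparentRule h _ => exact absurd hq (h q)
  | byRandom h _ _ => exact absurd hq (h q)

theorem IsVQL.parents_inl (h : N.IsVQL n) (v : N.V) :
    (N.refine (n + 1)).parents (.inl v) = Sum.inl '' N.parents v := by
  ext (x | e)
  · rw [Sum.inl_injective.mem_set_image]
    exact and_congr_left fun _ => refineGraph_adj_inl_inl
  · refine iff_of_false (fun he => ?_) (by simp)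
    have h₁ : n + 1 < N.layer v := he.2
    have h₂ := h.layer_le v
    omega

theorem IsVQL.parents_inr (h : N.IsVQL n) (e : N.mesh.edgeSet) :
    (N.refine (n + 1)).parents (.inr e) = Sum.inl '' {x | x ∈ (e : Sym2 N.V)} := by
  ext (x | f)
  · rw [Sum.inl_injective.mem_set_image]
    exact (and_iff_left (Nat.lt_succ_of_le (h.layer_le x))).trans refineGraph_adj_inr_inl
  · exact iff_of_false (fun hf => lt_irrefl (n + 1) hf.2) (by simp)

theorem IsVQL.parents_inr_eq_pair (h : N.IsVQL n) {e : N.mesh.edgeSet} {x y : N.V}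
    (he : (e : Sym2 N.V) = s(x, y)) :
    (N.refine (n + 1)).parents (.inr e) = {Sum.inl x, Sum.inl y} := by
  rw [h.parents_inr, he, ← Set.image_pair]
  congr 1
  ext
  simp

theorem eq_pair_of_image_inl_eq_pair {V W : Type} {S : Set V} {p q : V ⊕ W}
    (h : Sum.inl '' S = {p, q}) : ∃ p' q', p = .inl p' ∧ q = .inl q' ∧ S = {p', q'} := by
  obtain ⟨p', -, rfl⟩ : p ∈ Sum.inl '' S := h ▸ Set.mem_insert p _
  obtain ⟨q', -, rfl⟩ : q ∈ Sum.inl '' S := h ▸ Set.mem_insert_of_mem _ rfl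
  exact ⟨p', q', rfl, rfl, Sum.inl_injective.image_injective (h.trans (Set.image_pair ..).symm)⟩

theorem IsVQL.parentRule_inl_iff (h : N.IsVQL n) (v : N.V) (p : (N.refine (n + 1)).V) :
    (N.refine (n + 1)).ParentRule (.inl v) p ↔ ∃ q, p = .inl q ∧ N.ParentRule v q := by
  constructor
  · rintro ⟨hv, p₂, hp, hl⟩
    rw [h.parents_inl] at hp
    obtain ⟨q, q₂, rfl, rfl, hq⟩ := eq_pair_of_image_inl_eq_pair hp
    exact ⟨q, rfl, hv, q₂, hq, hl⟩
  · rintro ⟨q, rfl, hv, q₂, hq, hl⟩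
    refine ⟨hv, .inl q₂, ?_, hl⟩
    rw [h.parents_inl, hq, Set.image_pair]

theorem IsVQL.grandparentRule_inl_iff (h : N.IsVQL n) (v : N.V) (p : (N.refine (n + 1)).V) :
    (N.refine (n + 1)).GrandparentRule (.inl v) p ↔ ∃ q, p = .inl q ∧ N.GrandparentRule v q := by
  constructor
  · rintro ⟨hv, hc, p₂, hp, hl, g₁, g₂, g₃, hg, hg', hl₂, hl₃⟩
    rw [h.parents_inl] at hp hc
    obtain ⟨q, q₂, rfl, rfl, hq⟩ := eq_pair_of_image_inl_eq_pair hp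
    rw [h.parents_inl] at hg hg'
    obtain ⟨g₁, g₂, rfl, rfl, hgq⟩ := eq_pair_of_image_inl_eq_pair hg
    obtain ⟨g₂', g₃, hg₂, rfl, hgq'⟩ := eq_pair_of_image_inl_eq_pair hg'
    cases hg₂
    exact ⟨q, rfl, hv, fun c hcv => hc _ (Set.mem_image_of_mem _ hcv), q₂, hq, hl, g₁, g₂, g₃,
      hgq, hgq', hl₂, hl₃⟩
  · rintro ⟨q, rfl, hv, hc, q₂, hq, hl, g₁, g₂, g₃, hg, hg', hl₂, hl₃⟩
    refine ⟨hv, ?_, .inl q₂, ?_, hl, .inl g₁, .inl g₂, .inl g₃, ?_, ?_, hl₂, hl₃⟩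
    · rw [h.parents_inl]
      rintro _ ⟨c, hcv, rfl⟩
      exact hc c hcv
    · rw [h.parents_inl, hq, Set.image_pair]
    · rw [h.parents_inl, hg, Set.image_pair]
    · rw [h.parents_inl, hg', Set.image_pair]

/-- Later rounds of subdivision do not affect the choice of a best parent. -/
theorem IsVQL.bestParent_of_inl (h : N.IsVQL n) {v : N.V} {o : Option (N.refine (n + 1)).V}
    (hv : (N.refine (n + 1)).BestParent (.inl v) o) :
    ∃ o', o = o'.map Sum.inl ∧ N.BestParent v o' := by
  have hP : (∀ q, ¬ (N.refine (n + 1)).ParentRule (.inl v) q) → ∀ q, ¬ N.ParentRule v q :=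
    fun h' q hq => h' (.inl q) ((h.parentRule_inl_iff v _).mpr ⟨q, rfl, hq⟩)
  have hG : (∀ q, ¬ (N.refine (n + 1)).GrandparentRule (.inl v) q) →
      ∀ q, ¬ N.GrandparentRule v q :=
    fun h' q hq => h' (.inl q) ((h.grandparentRule_inl_iff v _).mpr ⟨q, rfl, hq⟩)
  cases hv with
  | byParentRule h₁ =>
    obtain ⟨q, rfl, hq⟩ := (h.parentRule_inl_iff v _).mp h₁
    exact ⟨some q, rfl, .byParentRule hq⟩
  | byGrandparentRule h₁ h₂ =>
    obtain ⟨q, rfl, hq⟩ := (h.grandparentRule_inl_iff v _).mp h₂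
    exact ⟨some q, rfl, .byGrandparentRule (hP h₁) hq⟩
  | byRandom h₁ h₂ h₃ =>
    rw [h.parents_inl] at h₃
    obtain ⟨q, hq, rfl⟩ := h₃
    exact ⟨some q, rfl, .byRandom (hP h₁) (hG h₂) hq⟩
  | fail h₁ h₂ h₃ =>
    rw [h.parents_inl, Set.image_eq_empty] at h₃
    exact ⟨none, rfl, .fail (hP h₁) (hG h₂) h₃⟩

/-! ### Best parents lie on geodesics -/

/-- In a triangle of a subdivided mesh, a vertex that is strictly closer to the target than the
other two is an old vertex, provided that the distance `D` to the target descends to parents above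
`t` and the target is at least that far away: the parent to which a midpoint descends is equal or
adjacent to another vertex of the triangle. -/
theorem exists_inl_of_strict_min {V : Type} {M G : SimpleGraph V} (hM : M ≤ G)
    (hK : NoTetrahedron M) {t : ℕ} {D : V ⊕ M.edgeSet → ℕ}
    (hD : DescendsFrom M t D) (hL : ∀ u v, (refineGraph M G).Adj u v → D u ≤ D v + 1)
    {x y z : V ⊕ M.edgeSet} (hxy : (loopSubdivision M).Adj x y)
    (hxz : (loopSubdivision M).Adj x z) (hyz : (loopSubdivision M).Adj y z)
    (ht : t ≤ D z) (hzx : D z < D x) (hzy : D z < D y) :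
    ∃ z' x' y', z = .inl z' ∧ x = .inr x' ∧ y = .inr y' := by
  rcases z with z | h
  · rcases x with x | f
    · exact hxz.elim
    rcases y with y | g
    · exact hyz.elim
    exact ⟨z, f, g, rfl, rfl, rfl⟩
  exfalso
  obtain ⟨u, hu, hdu⟩ := hD h ht
  -- An old vertex of the triangle is equal or adjacent to the parent `u`.
  have hinl : ∀ v : V, (loopSubdivision M).Adj (.inl v) (.inr h) → D (.inl v) ≤ D (.inr h) := by
    intro v hv
    rcases eq_or_adj_of_mem_edge (show v ∈ (h : Sym2 V) from hv) hu with rfl | hvu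
    · omega
    · have := hL (.inl v) (.inl u) (refineGraph_adj_inl_inl.mpr (hM hvu))
      omega
  have hinr : ∀ f : M.edgeSet, u ∈ (f : Sym2 V) → D (.inr f) ≤ D (.inr h) := by
    intro f hf
    have := hL (.inr f) (.inl u) (refineGraph_adj_inr_inl.mpr hf)
    omega
  rcases x with x | f
  · exact (hinl x hxz).not_gt hzx
  rcases y with y | g
  · exact (hinl y hyz).not_gt hzy
  obtain ⟨a, b, c, -, -, -, hf, hg, hh⟩ := hK.exists_triangle hxy hxz hyz
  rw [hh, Sym2.mem_iff] at hu
  rcases hu with rfl | rfl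
  · exact (hinr f (hf ▸ Sym2.mem_mk_right _ _)).not_gt hzx
  · exact (hinr g (hg ▸ Sym2.mem_mk_right _ _)).not_gt hzy

/-- Let `f` and `g` be the midpoints of two edges `x y` and `x z` of a triangle, and `e` the midpoint
of `f g`. If `g` is closer to a vertex far from `e` than `f`, then `z` is strictly closer to it than
`x` and `y`. -/
theorem IsVQL.dist_lt_of_dist_lt (h₀ : N.IsVQL n) {f g : N.mesh.edgeSet}
    {e : (N.refine (n + 1)).mesh.edgeSet} (he : (e : Sym2 (N.refine (n + 1)).V) = s(.inr f, .inr g))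
    {x y z : N.V} (hf : (f : Sym2 N.V) = s(x, y)) (hg : (g : Sym2 N.V) = s(x, z))
    (w : ((N.refine (n + 1)).refine (n + 2)).V)
    (hw : 6 < ((N.refine (n + 1)).refine (n + 2)).graph.dist (.inr e) w)
    (hlt : ((N.refine (n + 1)).refine (n + 2)).graph.dist (.inl (.inr g)) w <
      ((N.refine (n + 1)).refine (n + 2)).graph.dist (.inl (.inr f)) w) :
    5 ≤ ((N.refine (n + 1)).refine (n + 2)).graph.dist (.inl (.inl z)) w ∧
    ((N.refine (n + 1)).refine (n + 2)).graph.dist (.inl (.inl z)) w <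
      ((N.refine (n + 1)).refine (n + 2)).graph.dist (.inl (.inl x)) w ∧
    ((N.refine (n + 1)).refine (n + 2)).graph.dist (.inl (.inl z)) w <
      ((N.refine (n + 1)).refine (n + 2)).graph.dist (.inl (.inl y)) w := by
  have h₁ := h₀.refine
  have h₂ : ((N.refine (n + 1)).refine (n + 2)).IsVQL (n + 2) := h₁.refine
  have heg := dist_le_dist_add_one h₂.connected (u := .inr e) (v := .inl (.inr g))
    (refineGraph_adj_inr_inl.mpr (he ▸ Sym2.mem_mk_right _ _)) w
  have hfx := dist_le_dist_add_one h₂.connected (u := .inl (.inr f)) (v := .inl (.inl x))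
    (refineGraph_adj_inl_inl.mpr (refineGraph_adj_inr_inl.mpr (hf ▸ Sym2.mem_mk_left _ _))) w
  have hfy := dist_le_dist_add_one h₂.connected (u := .inl (.inr f)) (v := .inl (.inl y))
    (refineGraph_adj_inl_inl.mpr (refineGraph_adj_inr_inl.mpr (hf ▸ Sym2.mem_mk_right _ _))) w
  have hgz := dist_le_dist_add_one h₂.connected (u := .inl (.inr g)) (v := .inl (.inl z))
    (refineGraph_adj_inl_inl.mpr (refineGraph_adj_inr_inl.mpr (hg ▸ Sym2.mem_mk_right _ _))) w
  have hdesc := descendsFrom_dist_comp id h₁.connected h₁.mesh_le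
    (descendsFrom_dist h₀.connected h₀.mesh_le) w
  obtain ⟨c, hc, hcg⟩ := hdesc g (Nat.le_of_succ_le_succ
    (le_trans (by omega : 5 ≤ 7) (le_trans hw heg)))
  change ((N.refine (n + 1)).refine (n + 2)).graph.dist (.inl (.inl c)) w + 1 ≤
    ((N.refine (n + 1)).refine (n + 2)).graph.dist (.inl (.inr g)) w at hcg
  obtain rfl : c = z := by
    rw [hg, Sym2.mem_iff] at hc
    rcases hc with rfl | rfl
    · omega
    · rfl
  omega

/-- If `c` is the old corner of a triangle of the last mesh, then the Grandparent Rule does not allow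
to choose the midpoint of the edge opposite to `c`. -/
theorem IsVQL.not_bestParent_of_corner (hN : N.IsVQL n) {x y : N.mesh.edgeSet} {c : N.V}
    {f g : (N.refine (n + 1)).mesh.edgeSet}
    (hf : (f : Sym2 (N.refine (n + 1)).V) = s(.inr x, .inr y))
    (hg : (g : Sym2 (N.refine (n + 1)).V) = s(.inr x, .inl c))
    {e : ((N.refine (n + 1)).refine (n + 2)).mesh.edgeSet}
    (he : (e : Sym2 ((N.refine (n + 1)).refine (n + 2)).V) = s(.inr f, .inr g)) :
    ¬ (((N.refine (n + 1)).refine (n + 2)).refine (n + 3)).BestParent (.inr e)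
      (some (.inl (.inr f))) := by
  intro hb
  have h₀ := hN.refine
  have h₁ := h₀.refine
  have hlc : N.layer c < n + 1 := Nat.lt_succ_of_le (hN.layer_le c)
  have hPe := h₁.parents_inr_eq_pair he
  have hPf : (((N.refine (n + 1)).refine (n + 2)).refine (n + 3)).parents (.inl (.inr f)) =
      {.inl (.inl (.inr x)), .inl (.inl (.inr y))} := by
    rw [h₁.parents_inl, h₀.parents_inr_eq_pair hf, Set.image_pair]
  have hPg : (((N.refine (n + 1)).refine (n + 2)).refine (n + 3)).parents (.inl (.inr g)) =
      {.inl (.inl (.inr x)), .inl (.inl (.inl c))} := by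
    rw [h₁.parents_inl, h₀.parents_inr_eq_pair hg, Set.image_pair]
  have hGg : (((N.refine (n + 1)).refine (n + 2)).refine (n + 3)).GrandparentRule (.inr e)
      (.inl (.inr g)) := by
    refine ⟨show 2 ≤ n + 3 by omega, ?_, .inl (.inr f), ?_, rfl, .inl (.inl (.inl c)),
      .inl (.inl (.inr x)), .inl (.inl (.inr y)), ?_, hPf, hlc, hlc⟩
    · rw [hPe]
      rintro _ (rfl | rfl) <;> exact Nat.succ_le_succ (Nat.zero_le (n + 1))
    · rw [hPe, Set.pair_comm]
    · rw [hPg, Set.pair_comm]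
  cases hb with
  | byParentRule h =>
    obtain ⟨-, q₂, hq, hl⟩ := h
    rw [hPe, Set.pair_eq_pair_iff] at hq
    rcases hq with ⟨-, rfl⟩ | ⟨rfl, h⟩
    · exact lt_irrefl _ hl
    · exact lt_irrefl _ hl
  | byRandom _ h _ => exact h _ hGg
  | byGrandparentRule _ h =>
    -- Both parents of the midpoint of `x y` lie on the same layer.
    obtain ⟨-, -, q, -, -, g₁, g₂, g₃, hg₁, -, hl, -⟩ := h
    rw [hPf, Set.pair_eq_pair_iff] at hg₁
    rcases hg₁ with ⟨rfl, rfl⟩ | ⟨rfl, rfl⟩ <;> exact lt_irrefl _ hl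

/-- The distance in the second refinement of the icosahedron between a vertex of the icosahedron and
any vertex exceeds a distance in the icosahedron by at most two. -/
theorem exists_dist_le_icosahedron_dist_add_two
    (w : (((vqlNetwork 0).refine 1).refine 2).V) : ∃ w₀ : Fin 12, ∀ u : Fin 12,
      (((vqlNetwork 0).refine 1).refine 2).graph.dist (.inl (.inl u)) w ≤
        icosahedron.dist u w₀ + 2 := by
  have h₀ := isVQL_vqlNetwork 0
  have h₁ := h₀.refine
  obtain ⟨w₁, hw₁⟩ := exists_dist_inl_le_one 2 w
  obtain ⟨w₀, hw₀⟩ := exists_dist_inl_le_one 1 w₁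
  refine ⟨w₀, fun u => ?_⟩
  have e₁ := h₁.refine.connected.dist_triangle (u := .inl (.inl u)) (v := .inl w₁) (w := w)
  have e₂ := refineGraph_dist_inl_inl h₁.connected h₁.mesh_le (.inl u) w₁
  have e₃ := h₁.connected.dist_triangle (u := .inl u) (v := .inl w₀) (w := w₁)
  have e₄ := refineGraph_dist_inl_inl h₀.connected h₀.mesh_le u w₀
  change _ = icosahedron.dist u w₀ at e₄
  simp only [zero_add, Nat.reduceAdd] at *
  omega

/-- The case of two parents on the same layer: these are the midpoints of two edges `x y` and `x z`
of a triangle. If the parent on `x z` is closer to the target, then `z` is the corner at an old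
vertex, and the Grandparent Rule selects just this parent. If the triangle is a face of the
icosahedron, no vertex of the network is far enough away. -/
theorem dist_le_of_bestParent_inr (m : ℕ) {f g : (vqlNetwork m).mesh.edgeSet}
    {e : ((vqlNetwork m).refine (m + 1)).mesh.edgeSet}
    (he : (e : Sym2 ((vqlNetwork m).refine (m + 1)).V) = s(.inr f, .inr g))
    (w : (((vqlNetwork m).refine (m + 1)).refine (m + 2)).V)
    (hw : 6 < (((vqlNetwork m).refine (m + 1)).refine (m + 2)).graph.dist (.inr e) w)
    (hb : (((vqlNetwork m).refine (m + 1)).refine (m + 2)).BestParent (.inr e)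
      (some (.inl (.inr f)))) :
    (((vqlNetwork m).refine (m + 1)).refine (m + 2)).graph.dist (.inl (.inr f)) w ≤
      (((vqlNetwork m).refine (m + 1)).refine (m + 2)).graph.dist (.inl (.inr g)) w := by
  have h₀ := isVQL_vqlNetwork m
  have h₁ := h₀.refine
  have hfg : (loopSubdivision (vqlNetwork m).mesh).Adj (.inr f) (.inr g) := by
    have := e.2
    rwa [he] at this
  obtain ⟨x, y, z, hxy, hxz, hyz, hf, hg⟩ := hfg
  by_contra! hlt
  obtain ⟨hz, hzx, hzy⟩ := h₀.dist_lt_of_dist_lt he hf hg w hw hlt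
  have hL : ∀ u v : (vqlNetwork m).V, (vqlNetwork m).graph.Adj u v →
      (((vqlNetwork m).refine (m + 1)).refine (m + 2)).graph.dist (.inl (.inl u)) w ≤
        (((vqlNetwork m).refine (m + 1)).refine (m + 2)).graph.dist (.inl (.inl v)) w + 1 :=
    fun u v h => dist_le_dist_add_one h₁.refine.connected
      (refineGraph_adj_inl_inl.mpr (refineGraph_adj_inl_inl.mpr h)) w
  rcases m with _ | r
  · obtain ⟨w₀, hd⟩ := exists_dist_le_icosahedron_dist_add_two w
    have hx := hd x
    have hy := hd y
    simp only [zero_add] at *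
    rcases icosahedron_dist_le_two_of_adj hxy w₀ with h | h <;> omega
  · have hN := isVQL_vqlNetwork r
    obtain ⟨c, x', y', rfl, rfl, rfl⟩ := exists_inl_of_strict_min hN.mesh_le hN.noTetrahedron
      (descendsFrom_dist_comp Sum.inl h₁.connected h₁.mesh_le
        (descendsFrom_dist_comp id h₀.connected h₀.mesh_le
          (descendsFrom_dist hN.connected hN.mesh_le)) w) hL hxy hxz hyz hz hzx hzy
    exact hN.not_bestParent_of_corner hf hg he hb

/-- No endpoint of an edge is closer to a far vertex than the best parent of the midpoint. -/
theorem dist_le_of_bestParent (k : ℕ) {p q : (vqlNetwork k).V} {e : (vqlNetwork k).mesh.edgeSet}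
    (he : (e : Sym2 (vqlNetwork k).V) = s(p, q)) (w : ((vqlNetwork k).refine (k + 1)).V)
    (hw : 6 < ((vqlNetwork k).refine (k + 1)).graph.dist (.inr e) w)
    (hb : ((vqlNetwork k).refine (k + 1)).BestParent (.inr e) (some (.inl p))) :
    ((vqlNetwork k).refine (k + 1)).graph.dist (.inl p) w ≤
      ((vqlNetwork k).refine (k + 1)).graph.dist (.inl q) w := by
  have h₀ := isVQL_vqlNetwork k
  have h₁ := h₀.refine
  have hep : ((vqlNetwork k).refine (k + 1)).graph.dist (.inr e) w ≤
      ((vqlNetwork k).refine (k + 1)).graph.dist (.inl p) w + 1 :=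
    dist_le_dist_add_one h₁.connected
      (refineGraph_adj_inr_inl.mpr (he ▸ Sym2.mem_mk_left p q)) w
  have heq : ((vqlNetwork k).refine (k + 1)).graph.dist (.inr e) w ≤
      ((vqlNetwork k).refine (k + 1)).graph.dist (.inl q) w + 1 :=
    dist_le_dist_add_one h₁.connected
      (refineGraph_adj_inr_inl.mpr (he ▸ Sym2.mem_mk_right p q)) w
  rcases k with _ | m
  · obtain ⟨w₀, hw₀⟩ := exists_dist_inl_le_one 1 w
    have e₁ := h₁.connected.dist_triangle (u := .inl p) (v := .inl w₀) (w := w)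
    have e₂ : ((vqlNetwork 0).refine 1).graph.dist (.inl p) (.inl w₀) = icosahedron.dist p w₀ :=
      refineGraph_dist_inl_inl h₀.connected h₀.mesh_le _ _
    have e₃ := icosahedron_dist_le_three p w₀
    simp only [zero_add] at *
    omega
  · have hpq : (loopSubdivision (vqlNetwork m).mesh).Adj p q := by
      have := e.2
      rw [he] at this
      exact this
    rcases p with x | f <;> rcases q with y | g
    · exact hpq.elim
    · -- The midpoint `g` descends to an endpoint equal or adjacent to `x`.
      have hN := isVQL_vqlNetwork m
      obtain ⟨c, hc, hd⟩ := descendsFrom_dist_comp id h₀.connected h₀.mesh_le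
        (descendsFrom_dist hN.connected hN.mesh_le) w g (Nat.le_of_succ_le_succ
          (le_trans (by omega : 5 ≤ 7) (le_trans hw heq)))
      have hxc : ((vqlNetwork (m + 1)).refine (m + 1 + 1)).graph.dist (.inl (.inl x)) w ≤
          ((vqlNetwork (m + 1)).refine (m + 1 + 1)).graph.dist (.inl (.inl c)) w + 1 := by
        refine dist_le_dist_add_one_of_eq_or_adj h₁.connected ?_ w
        refine (eq_or_adj_of_mem_edge (show x ∈ (g : Sym2 _) from hpq) hc).imp ?_ fun h => ?_
        · rintro rfl; rfl
        · exact refineGraph_adj_inl_inl.mpr (refineGraph_adj_inl_inl.mpr (hN.mesh_le h))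
      exact hxc.trans hd
    · have hP : ((vqlNetwork (m + 1)).refine (m + 1 + 1)).ParentRule (.inr e) (.inl (.inl y)) := by
        refine ⟨show 1 ≤ m + 1 + 1 by omega, .inl (.inr f), ?_,
          Nat.lt_succ_of_le ((isVQL_vqlNetwork m).layer_le y)⟩
        rw [h₀.parents_inr_eq_pair he, Set.pair_comm]
      have := hb.eq_of_parentRule hP
      cases this
    · exact dist_le_of_bestParent_inr m he w hw hb

/-- A best parent of a vertex lies on a geodesic to every far vertex of the same or a lower layer. -/
theorem bestParent_vqlNetwork (k : ℕ) : ∀ (v w : (vqlNetwork k).V),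
    (vqlNetwork k).layer w ≤ (vqlNetwork k).layer v → 6 < (vqlNetwork k).graph.dist v w →
    ∀ o, (vqlNetwork k).BestParent v o → ∃ p, o = some p ∧ (vqlNetwork k).graph.Adj v p ∧
      (vqlNetwork k).graph.dist p w + 1 = (vqlNetwork k).graph.dist v w := by
  induction k with
  | zero =>
    intro v w _ hd
    have : icosahedron.dist v w ≤ 3 := icosahedron_dist_le_three v w
    change 6 < icosahedron.dist v w at hd
    omega
  | succ k ih =>
    have h₀ := isVQL_vqlNetwork k
    change ∀ v w : ((vqlNetwork k).refine (k + 1)).V,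
      ((vqlNetwork k).refine (k + 1)).layer w ≤ ((vqlNetwork k).refine (k + 1)).layer v →
      6 < ((vqlNetwork k).refine (k + 1)).graph.dist v w →
      ∀ o, ((vqlNetwork k).refine (k + 1)).BestParent v o →
        ∃ p, o = some p ∧ ((vqlNetwork k).refine (k + 1)).graph.Adj v p ∧
          ((vqlNetwork k).refine (k + 1)).graph.dist p w + 1 =
            ((vqlNetwork k).refine (k + 1)).graph.dist v w
    have hiso : ∀ x y, ((vqlNetwork k).refine (k + 1)).graph.dist (.inl x) (.inl y) =
      (vqlNetwork k).graph.dist x y := refineGraph_dist_inl_inl h₀.connected h₀.mesh_le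
    rintro (v | e) w hl hd o ho
    · rcases w with w | f
      · rw [hiso] at hd
        obtain ⟨o', rfl, ho'⟩ := h₀.bestParent_of_inl ho
        obtain ⟨p, rfl, hadj, hp⟩ := ih v w hl hd o' ho'
        refine ⟨.inl p, rfl, refineGraph_adj_inl_inl.mpr hadj, ?_⟩
        rw [hiso, hiso, hp]
      · have h₁ : k + 1 ≤ (vqlNetwork k).layer v := hl
        have h₂ := h₀.layer_le v
        omega
    · have hpar := h₀.parents_inr e
      obtain ⟨x, hx⟩ := exists_mem_edge e
      obtain ⟨_, hp, rfl⟩ := ho.exists_mem ⟨.inl x, hpar ▸ Set.mem_image_of_mem _ hx⟩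
      rw [hpar] at hp
      obtain ⟨p, hp, rfl⟩ := hp
      have hadj : ((vqlNetwork k).refine (k + 1)).graph.Adj (.inr e) (.inl p) :=
        refineGraph_adj_inr_inl.mpr hp
      refine ⟨_, rfl, hadj, le_antisymm ?_ (dist_le_dist_add_one h₀.refine.connected hadj w)⟩
      obtain ⟨q, hq, hqd⟩ :=
        descendsFrom_dist h₀.connected h₀.mesh_le w e (le_trans (by omega) hd)
      refine le_trans (Nat.succ_le_succ ?_) hqd
      obtain ⟨q', hq'⟩ := hp
      rw [hq', Sym2.mem_iff] at hq
      rcases hq with rfl | rfl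
      · exact le_rfl
      · exact dist_le_of_bestParent k hq' w hd ho

/-! ### The routing algorithm -/

theorem exists_decides (k : ℕ) (α β : (vqlNetwork k).V) : ∃ o, (vqlNetwork k).Decides α β o := by
  have := (isVQL_vqlNetwork k).finite
  by_cases h : β ∈ (vqlNetwork k).neighbourhood α
  · obtain ⟨_ | P, ho⟩ :=
      exists_dijkstraReturns (vqlNetwork k).graph ((vqlNetwork k).neighbourhood α) α β
    exacts [⟨_, .nearFail h ho⟩, ⟨_, .near h ho⟩]
  rcases lt_or_ge ((vqlNetwork k).layer α) ((vqlNetwork k).layer β) with hl | hl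
  · obtain ⟨_ | p, ho⟩ := exists_bestParent β
    exacts [⟨_, .receiverFail h hl ho⟩, ⟨_, .receiver h hl ho⟩]
  · obtain ⟨_ | p, ho⟩ := exists_bestParent α
    exacts [⟨_, .senderFail h hl ho⟩, ⟨_, .sender h hl ho⟩]

variable {k : ℕ} {α β : (vqlNetwork k).V}

theorem isShortestPath_of_decides_direct {P : List (vqlNetwork k).V}
    (h : (vqlNetwork k).Decides α β (.direct P)) : (vqlNetwork k).IsShortestPath α β P := by
  cases h with
  | near h hP =>
    obtain ⟨P', hP', hgeo⟩ := hP.isGeodesicList (isVQL_vqlNetwork k).connected h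
    cases hP'
    exact hgeo

theorem not_decides_failure : ¬ (vqlNetwork k).Decides α β .failure := by
  intro h
  cases h with
  | nearFail h hP =>
    obtain ⟨P, hP, -⟩ := hP.isGeodesicList (isVQL_vqlNetwork k).connected h
    cases hP
  | receiverFail h hl hp =>
    obtain ⟨p, hp, -⟩ := bestParent_vqlNetwork k β α hl.le
      (by rw [SimpleGraph.dist_comm]; exact not_le.mp h) _ hp
    cases hp
  | senderFail h hl hp =>
    obtain ⟨p, hp, -⟩ := bestParent_vqlNetwork k α β hl (not_le.mp h) _ hp
    cases hp

theorem adj_and_dist_of_decides_senderStep {p : (vqlNetwork k).V}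
    (h : (vqlNetwork k).Decides α β (.senderStep p)) : (vqlNetwork k).graph.Adj α p ∧
      (vqlNetwork k).graph.dist p β + 1 = (vqlNetwork k).graph.dist α β := by
  cases h with
  | sender h hl hp =>
    obtain ⟨q, hq, hadj⟩ := bestParent_vqlNetwork k α β hl (not_le.mp h) _ hp
    cases hq
    exact hadj

theorem adj_and_dist_of_decides_receiverStep {p : (vqlNetwork k).V}
    (h : (vqlNetwork k).Decides α β (.receiverStep p)) : (vqlNetwork k).graph.Adj β p ∧
      (vqlNetwork k).graph.dist α p + 1 = (vqlNetwork k).graph.dist α β := by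
  cases h with
  | receiver h hl hp =>
    obtain ⟨q, hq, hadj, hd⟩ := bestParent_vqlNetwork k β α hl.le
      (by rw [SimpleGraph.dist_comm]; exact not_le.mp h) _ hp
    cases hq
    rw [SimpleGraph.dist_comm, SimpleGraph.dist_comm (u := β)] at hd
    exact ⟨hadj, hd⟩

theorem optimalDecision_of_decides (hne : α ≠ β) {o : Decision (vqlNetwork k).V}
    (h : (vqlNetwork k).Decides α β o) : (vqlNetwork k).OptimalDecision α β o := by
  cases o with
  | direct P =>
    obtain ⟨hh, hl, hc, hlen⟩ := isShortestPath_of_decides_direct h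
    have hconn := (isVQL_vqlNetwork k).connected
    have hpos := hconn.pos_dist_of_ne hne
    match P, hh, hl, hc, hlen with
    | [], hh, _, _, _ => simp at hh
    | [x], _, _, _, hlen =>
      rw [List.length_singleton] at hlen
      omega
    | x :: p :: rest, hh, hl, hc, hlen =>
      simp only [List.head?_cons, Option.some.injEq] at hh
      subst hh
      rw [List.isChain_cons_cons] at hc
      rw [List.getLast?_cons_cons] at hl
      obtain ⟨q, hq⟩ := exists_walk_of_isChain (p :: rest) p rfl hl hc.2
      have h₁ := dist_le q
      have h₂ := dist_le_dist_add_one hconn hc.1 β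
      rw [List.length_cons] at hlen
      exact ⟨p, rest, rfl, hc.1, by omega⟩
  | senderStep p => exact adj_and_dist_of_decides_senderStep h
  | receiverStep p => exact adj_and_dist_of_decides_receiverStep h
  | failure => exact not_decides_failure h

/-- The distance from sender to receiver decreases with each recursive call. -/
theorem exists_returns (n : ℕ) : ∀ α β : (vqlNetwork k).V, (vqlNetwork k).graph.dist α β = n →
    ∃ r, (vqlNetwork k).Returns α β r := by
  induction n using Nat.strong_induction_on with
  | _ n ih =>
    intro α β hn
    obtain ⟨o, ho⟩ := exists_decides k α β
    cases o with
    | direct P => exact ⟨_, .direct ho⟩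
    | failure => exact ⟨_, .failure ho⟩
    | senderStep p =>
      have := (adj_and_dist_of_decides_senderStep ho).2
      obtain ⟨r, hr⟩ := ih _ (by omega) p β rfl
      exact ⟨_, .sender ho hr⟩
    | receiverStep p =>
      have := (adj_and_dist_of_decides_receiverStep ho).2
      obtain ⟨r, hr⟩ := ih _ (by omega) α p rfl
      exact ⟨_, .receiver ho hr⟩

theorem isShortestPath_of_returns {r : Option (List (vqlNetwork k).V)}
    (h : (vqlNetwork k).Returns α β r) :
    ∃ P, r = some P ∧ (vqlNetwork k).IsShortestPath α β P := by
  induction h with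
  | direct h => exact ⟨_, rfl, isShortestPath_of_decides_direct h⟩
  | failure h => exact absurd h not_decides_failure
  | @receiver a b p r h _ ih =>
    obtain ⟨P, rfl, hh, hl, hc, hlen⟩ := ih
    obtain ⟨hadj, hd⟩ := adj_and_dist_of_decides_receiverStep h
    refine ⟨_, rfl, by simp [List.head?_append, hh], by simp, ?_, by simp [hlen, ← hd]⟩
    rw [List.isChain_append]
    refine ⟨hc, by simp, fun x hx y hy => ?_⟩
    rw [hl] at hx
    simp only [Option.mem_def, Option.some.injEq, List.head?_cons] at hx hy
    subst hx; subst hy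
    exact hadj.symm
  | @sender a b p r h _ ih =>
    obtain ⟨P, rfl, hh, hl, hc, hlen⟩ := ih
    obtain ⟨hadj, hd⟩ := adj_and_dist_of_decides_senderStep h
    cases P with
    | nil => simp at hh
    | cons x P =>
      simp only [List.head?_cons, Option.some.injEq] at hh
      subst hh
      exact ⟨_, rfl, rfl, by rw [List.getLast?_cons_cons, hl], hc.cons_cons hadj,
        by rw [List.length_cons, hlen, hd]⟩

end Network

end SphereRouting

theorem mainTheorem2 (k : ℕ) (α β : (SphereRouting.vqlNetwork k).V) :
    (α ≠ β →
      (∃ o, (SphereRouting.vqlNetwork k).Decides α β o) ∧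
      ∀ o, (SphereRouting.vqlNetwork k).Decides α β o →
        (SphereRouting.vqlNetwork k).OptimalDecision α β o) ∧
    (∃ r, (SphereRouting.vqlNetwork k).Returns α β r) ∧
    (∀ r, (SphereRouting.vqlNetwork k).Returns α β r →
      ∃ P, r = some P ∧ (SphereRouting.vqlNetwork k).IsShortestPath α β P) :=
  ⟨fun h => ⟨SphereRouting.Network.exists_decides k α β,
    fun _ => SphereRouting.Network.optimalDecision_of_decides h⟩,
    SphereRouting.Network.exists_returns _ α β rfl,
    fun _ => SphereRouting.Network.isShortestPath_of_returns⟩
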